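/- Let $\mathsf G$ be a connected metric graph with finitely many vertices and finitely many edges, each edge $\mathsf e$ being identified with an interval $[0,|\mathsf e|]$ of finite length $|\mathsf e|>0$; loops and multiple edges are allowed. Let $V$ be the number of vertices of $\mathsf G$ and assume $V\ge 2$. For two points $x,y\in\mathsf G$ (vertices or points on edges) let $\operatorname{dist}(x,y)$ be the length of the shortest path within $\mathsf G$ connecting them, let $$D=\sup\{\operatorname{dist}(x,y): x,y\in\mathsf G\}$$ be the diameter of $\mathsf G$, and let $$D_{\mathsf V}=\sup\{\operatorname{dist}(v,w): v,w \text{ vertices of } \mathsf G\}$$ be its combinatorial diameter. Let $-\Delta$ be the Laplacian on $L^2(\mathsf G)$ with natural vertex conditions: its domain consists of the functions $u$ which belong to $H^2$ on each edge, are continuous at the vertices, and whose derivatives at each vertex, taken in the directions pointing into the edges, sum to $0$ (a loop contributing twice), and $-\Delta u=-u''$ on each edge. Let $\lambda_1(\mathsf G)$ be the spectral gap, that is, the smallest positive eigenvalue of $-\Delta$. (It exists.) Then $$\lambda_1(\mathsf G)\le\frac{\pi^2}{D^2}(V+1)^2$$ and $$\lambda_1(\mathsf G)\le\frac{\pi^2}{D_{\mathsf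 V}^2}(V-1)^2 .$$ -/

import Mathlib

/-- A metric graph with vertex set `V` and edge set `E`; loops and multiple edges are allowed.
The edge `e` is identified with the interval `[0, len e]`, where `0` corresponds to the vertex
`src e` and `len e` to the vertex `tgt e`. The orientation is only used to parametrise the edge. -/
structure MetricGraph (V E : Type*) where
  src : E → V
  tgt : E → V
  len : E → ℝ
  len_pos : ∀ e, 0 < len e

namespace MetricGraph

variable {V E : Type*}

/-- The points of the metric graph: its vertices and the interior points of its edges. -/
inductive Point (G : MetricGraph V E) : Type _
  | vertex (v : V) : Point G
  | inner (e : E) (t : ℝ) (ht : t ∈ Set.Ioo 0 (G.len e)) : Point G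

/-- The point `x` lies on the (closed) edge `e`, at the coordinate `s ∈ [0, len e]`.
(A vertex carrying a loop `e` has both coordinates `0` and `len e`.) -/
def OnEdge (G : MetricGraph V E) : G.Point → E → ℝ → Prop
  | .vertex v, e, s => (s = 0 ∧ G.src e = v) ∨ (s = G.len e ∧ G.tgt e = v)
  | .inner e' t _, e, s => e' = e ∧ t = s

/-- `G.IsPathLength x y c`: there is a path in `G` from `x` to `y`, composed of finitely many
segments each of which runs inside one edge, of total length `c`. -/
inductive IsPathLength (G : MetricGraph V E) : G.Point → G.Point → ℝ → Prop
  | nil (x : G.Point) : IsPathLength G x x 0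
  | cons {x y z : G.Point} {e : E} {s t c : ℝ} (hx : G.OnEdge x e s) (hy : G.OnEdge y e t)
      (hyz : IsPathLength G y z c) : IsPathLength G x z (|s - t| + c)

/-- Any two points are joined by a path. -/
def Connected (G : MetricGraph V E) : Prop :=
  ∀ x y : G.Point, ∃ c, G.IsPathLength x y c

/-- The length of the shortest path between two points. -/
noncomputable def dist (G : MetricGraph V E) (x y : G.Point) : ℝ :=
  sInf {c | G.IsPathLength x y c}

/-- The diameter: the supremum of the distances between arbitrary points. -/
noncomputable def diam (G : MetricGraph V E) : ℝ :=
  sSup {d | ∃ x y : G.Point, d = G.dist x y}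

/-- The combinatorial diameter: the supremum of the distances between vertices. -/
noncomputable def vertexDiam (G : MetricGraph V E) : ℝ :=
  sSup {d | ∃ v w : V, d = G.dist (.vertex v) (.vertex w)}

open Classical in
/-- `G.HasLaplacian u g`: the function `u` lies in the domain of the Laplacian `Δ` of `G` with
continuity and Kirchhoff conditions at the vertices, and `Δ u = g`. Functions on `G` are given on
each edge `e` by their values on `[0, len e]`. On every edge `u` is in `H²`, that is, `u` is `C¹`
with derivative `u'`, and `u'` is an antiderivative of the `L²` function `g`; at every vertex the
values of `u` agree (their common value is `φ v`), and the derivatives of `u` in the directions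
pointing from the vertex into the edges sum to `0`. -/
def HasLaplacian [Fintype E] (G : MetricGraph V E) (u g : E → ℝ → ℝ) : Prop :=
  ∃ (φ : V → ℝ) (u' : E → ℝ → ℝ),
    (∀ e, u e 0 = φ (G.src e) ∧ u e (G.len e) = φ (G.tgt e)) ∧
    (∀ e, ∀ t ∈ Set.Icc 0 (G.len e),
      HasDerivWithinAt (u e) (u' e t) (Set.Icc 0 (G.len e)) t) ∧
    (∀ e, MeasureTheory.MemLp (g e) 2
      (MeasureTheory.volume.restrict (Set.Icc 0 (G.len e)))) ∧
    (∀ e, ∀ t ∈ Set.Icc 0 (G.len e), u' e t = u' e 0 + ∫ s in (0 : ℝ)..t, g e s) ∧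
    (∀ v, (∑ e with G.src e = v, u' e 0) + (∑ e with G.tgt e = v, -u' e (G.len e)) = 0)

/-- `μ` is an eigenvalue of `-Δ`: there is a nonzero `u` in the domain with `-Δ u = μ u`. -/
def IsEigenvalue [Fintype E] (G : MetricGraph V E) (μ : ℝ) : Prop :=
  ∃ u : E → ℝ → ℝ, (∃ e, ∃ t ∈ Set.Icc 0 (G.len e), u e t ≠ 0) ∧
    G.HasLaplacian u (fun e t => -(μ * u e t))

/-- The spectral gap `λ₁`: the smallest positive eigenvalue of `-Δ`. -/
noncomputable def spectralGap [Fintype E] (G : MetricGraph V E) : ℝ :=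
  sInf {μ | 0 < μ ∧ G.IsEigenvalue μ}

end MetricGraph

open Set

/-! The bounds come from test functions. If every edge across some cut of the vertex set has length
at least `L`, take `1` on one side, `-1` on the other and half a cosine period on crossing edges; if
some edge has length at least `2 L`, take `1` elsewhere and a full cosine period on that edge.
Either way `λ₁ ≤ (π / L)²` (`isLeast_spectralGap_of_cut`, `isLeast_spectralGap_of_edge`). If every
cut is crossed by an edge shorter than `L`, the short edges connect all vertices, so two vertices
are less than `(V - 1) L` apart. If moreover all edges are shorter than `2 L`, two points are less
than `(V + 1) L` apart. Taking `L = D_V / (V - 1)` or `L = D / (V + 1)` rules this out.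

The variational principle is proved in finite dimensions. Edges are cut into segments so short that
`k * mesh < π` for all relevant `k`. A solution of `u'' = -k² u` on a segment is then determined by
its end values, and `∫ u'² - k² ∫ u²` becomes an explicit quadratic form `gridForm` in the grid
values, whose kernel for `k > 0` consists of the grid values of eigenfunctions for `k²`. Adding `C *
(∫ u)²` penalizes constants: the form is positive definite at `k = 0`, and a test function destroys
this at `k = K`. At the first `k` where definiteness fails (`exists_first_degenerate`) the kernel
gives the smallest positive eigenvalue, which shows both existence and `λ₁ ≤ K²`
(`isLeast_spectralGap_of_gridForm_nonpos`). -/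

/-! ### Trigonometric solutions and the first loss of definiteness -/

/-- A solution of `u'' = -k² u` on an interval starting at `0` is a trigonometric function. -/
theorem eq_cos_add_sin_of_hasDerivWithinAt {u u' : ℝ → ℝ} {k l : ℝ} (hk : k ≠ 0)
    (hu : ∀ t ∈ Icc 0 l, HasDerivWithinAt u (u' t) (Icc 0 l) t)
    (hu' : ∀ t ∈ Icc 0 l, HasDerivWithinAt u' (-(k ^ 2 * u t)) (Icc 0 l) t) :
    ∀ t ∈ Icc 0 l, u t = u 0 * Real.cos (k * t) + u' 0 / k * Real.sin (k * t) ∧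
      u' t = -(k * u 0) * Real.sin (k * t) + u' 0 * Real.cos (k * t) := by
  have hc : ∀ t, HasDerivAt (fun t => Real.cos (k * t)) (-Real.sin (k * t) * (k * 1)) t :=
    fun t => ((hasDerivAt_id t).const_mul k).cos
  have hs : ∀ t, HasDerivAt (fun t => Real.sin (k * t)) (Real.cos (k * t) * (k * 1)) t :=
    fun t => ((hasDerivAt_id t).const_mul k).sin
  have const : ∀ f : ℝ → ℝ, (∀ t ∈ Icc 0 l, HasDerivWithinAt f 0 (Icc 0 l) t) →
      ∀ t ∈ Icc 0 l, f t = f 0 := by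
    intro f hf t ht
    refine constant_of_has_deriv_right_zero (fun x hx => (hf x hx).continuousWithinAt)
      (fun x hx => ?_) t ht
    exact (hf x (Ico_subset_Icc_self hx)).mono_of_mem_nhdsWithin
      (Icc_mem_nhdsGE_of_mem hx)
  intro t ht
  -- The vector `(k u, u')` rotates with angular speed `k`; the two functions below are its
  -- coordinates in the co-rotating frame, hence constant.
  have h1 := const (fun t => k * u t * Real.cos (k * t) - u' t * Real.sin (k * t)) (by
    intro t ht
    exact ((((hu t ht).const_mul k).mul (hc t).hasDerivWithinAt).sub
      ((hu' t ht).mul (hs t).hasDerivWithinAt)).congr_deriv (by ring)) t ht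
  have h2 := const (fun t => k * u t * Real.sin (k * t) + u' t * Real.cos (k * t)) (by
    intro t ht
    exact ((((hu t ht).const_mul k).mul (hs t).hasDerivWithinAt).add
      ((hu' t ht).mul (hc t).hasDerivWithinAt)).congr_deriv (by ring)) t ht
  simp only [mul_zero, Real.cos_zero, Real.sin_zero, mul_one, sub_zero, zero_add] at h1 h2
  have h3 := Real.sin_sq_add_cos_sq (k * t)
  constructor
  · have : k * u t = k * (u 0 * Real.cos (k * t) + u' 0 / k * Real.sin (k * t)) := by
      field_simp
      linear_combination Real.cos (k * t) * h1 + Real.sin (k * t) * h2 - k * u t * h3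
    exact mul_left_cancel₀ hk this
  · linear_combination Real.cos (k * t) * h2 - Real.sin (k * t) * h1 - u' t * h3

/-- In a continuous family of symmetric bilinear forms that starts positive definite and does not
stay so, there is a first parameter where positive definiteness is lost, and there the form is
degenerate. -/
theorem exists_first_degenerate {W : Type*} [Fintype W] {K : ℝ}
    (F : ℝ → (W → ℝ) → (W → ℝ) → ℝ)
    (hadd : ∀ k x y (t : ℝ), F k (x + t • y) (x + t • y) =
      F k x x + 2 * t * F k x y + t ^ 2 * F k y y)
    (hsmul : ∀ k x (t : ℝ), F k (t • x) (t • x) = t ^ 2 * F k x x)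
    (hcont : ContinuousOn (fun q : ℝ × (W → ℝ) => F q.1 q.2 q.2) (Icc 0 K ×ˢ univ))
    (hzero : ∀ x ≠ 0, 0 < F 0 x x) (hK : 0 ≤ K) (hneg : ∃ x ≠ 0, F K x x ≤ 0) :
    ∃ k ∈ Ioc 0 K, (∃ x ≠ 0, ∀ y, F k x y = 0) ∧
      ∀ j ∈ Ico 0 k, ∀ x ≠ 0, 0 < F j x x := by
  have normalize : ∀ k (x : W → ℝ), x ≠ 0 → ∃ z ∈ Metric.sphere (0 : W → ℝ) 1,
      F k z z = (‖x‖⁻¹) ^ 2 * F k x x := by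
    intro k x hx
    refine ⟨‖x‖⁻¹ • x, ?_, hsmul k x _⟩
    simp [norm_smul, inv_mul_cancel₀ (norm_ne_zero_iff.mpr hx)]
  -- Pairs of a parameter and a unit vector on which the form is nonpositive. This set is compact,
  -- so its projection to the parameter axis has a least element.
  set B : Set (ℝ × (W → ℝ)) := (Icc 0 K ×ˢ Metric.sphere (0 : W → ℝ) 1) ∩
    (fun q : ℝ × (W → ℝ) => F q.1 q.2 q.2) ⁻¹' Iic 0 with hB
  have hcomp : IsCompact (Icc 0 K ×ˢ Metric.sphere (0 : W → ℝ) 1) :=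
    isCompact_Icc.prod (isCompact_sphere _ _)
  have hBc : IsCompact B := hcomp.of_isClosed_subset
    ((hcont.mono (prod_mono_right (subset_univ _))).preimage_isClosed_of_isClosed
      hcomp.isClosed isClosed_Iic) inter_subset_left
  have hBn : B.Nonempty := by
    obtain ⟨x, hx, hxK⟩ := hneg
    obtain ⟨z, hz, hzF⟩ := normalize K x hx
    refine ⟨(K, z), ⟨⟨right_mem_Icc.mpr hK, hz⟩, ?_⟩⟩
    change F K z z ≤ 0
    rw [hzF]
    exact mul_nonpos_of_nonneg_of_nonpos (sq_nonneg _) hxK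
  obtain ⟨k, ⟨⟨q, ⟨⟨hqK, hqS⟩, hq0⟩, hqk⟩, hmin⟩⟩ :=
    (hBc.image continuous_fst).exists_isLeast (hBn.image _)
  obtain ⟨k', x⟩ := q
  obtain rfl : k' = k := hqk
  have hx0 : x ≠ 0 := by
    rintro rfl
    simp at hqS
  simp only [mem_preimage, mem_Iic] at hq0 hqK
  have hpos : ∀ j ∈ Ico 0 k', ∀ x ≠ 0, 0 < F j x x := by
    intro j hj x hx
    obtain ⟨z, hz, hzF⟩ := normalize j x hx
    by_contra! hle
    have : k' ≤ j := hmin ⟨(j, z), ⟨⟨⟨hj.1, hj.2.le.trans hqK.2⟩, hz⟩, by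
      change F j z z ≤ 0
      rw [hzF]
      exact mul_nonpos_of_nonneg_of_nonpos (sq_nonneg _) hle⟩, rfl⟩
    exact absurd hj.2 this.not_gt
  have hk0 : 0 < k' := lt_of_le_of_ne hqK.1 (by
    rintro rfl
    exact absurd (hzero x hx0) hq0.not_gt)
  -- Semidefiniteness at the first bad parameter is the limit of definiteness from the left.
  have hnonneg : ∀ y, 0 ≤ F k' y y := by
    intro y
    by_cases hy : y = 0
    · have := hsmul k' y 0
      simp only [zero_smul] at this
      rw [hy, this]; simp
    have hc : ContinuousOn (fun j => F j y y) (Icc 0 K) :=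
      hcont.comp (f := fun j => (j, y)) (by fun_prop) (fun j hj => ⟨hj, mem_univ _⟩)
    have hc' : ContinuousWithinAt (fun j => F j y y) (Ico 0 k') k' :=
      (hc k' hqK).mono (fun j hj => ⟨hj.1, hj.2.le.trans hqK.2⟩)
    have hcl : k' ∈ closure (Ico 0 k') := by
      rw [closure_Ico hk0.ne]
      exact right_mem_Icc.mpr hk0.le
    have : F k' y y ∈ closure (Ici (0 : ℝ)) :=
      hc'.mem_closure hcl (fun j hj => (hpos j hj y hy).le)
    simpa using this
  have hx00 : F k' x x = 0 := le_antisymm hq0 (hnonneg x)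
  refine ⟨k', ⟨hk0, hqK.2⟩, ⟨x, hx0, fun y => ?_⟩, hpos⟩
  -- A nonnegative quadratic in `t` without constant term has no linear term; its discriminant is `4
  -- * F k' x y ^ 2`.
  have h : ∀ t : ℝ, 0 ≤ F k' y y * (t * t) + 2 * F k' x y * t + 0 := by
    intro t
    have := hnonneg (x + t • y)
    rw [hadd, hx00] at this
    linarith
  have := discrim_le_zero h
  simp only [discrim] at this
  nlinarith [sq_nonneg (F k' x y)]

/-! ### Quadratic forms on a chain -/

/-- The quadratic form of a chain of `n + 1` unit segments with parameter `c`, polarized. -/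
def chainForm (n : ℕ) (c : ℝ) (a b : ℕ → ℝ) : ℝ :=
  ∑ i ∈ Finset.range (n + 1),
    (c * (a i * b i + a (i + 1) * b (i + 1)) - a i * b (i + 1) - a (i + 1) * b i)

/-- Twice the trapezoidal sum along a chain of `n + 1` unit segments. -/
def chainSum (n : ℕ) (a : ℕ → ℝ) : ℝ :=
  ∑ i ∈ Finset.range (n + 1), (a i + a (i + 1))

/-- Summation by parts for `chainForm`. -/
theorem chainForm_eq (n : ℕ) (c : ℝ) (a b : ℕ → ℝ) :
    chainForm n c a b = (c * a 0 - a 1) * b 0 + (c * a (n + 1) - a n) * b (n + 1) +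
      ∑ i ∈ Finset.range n, (2 * c * a (i + 1) - a i - a (i + 2)) * b (i + 1) := by
  induction n with
  | zero => simp [chainForm]; ring
  | succ n ih =>
    have h : chainForm (n + 1) c a b = chainForm n c a b +
        (c * (a (n + 1) * b (n + 1) + a (n + 1 + 1) * b (n + 1 + 1)) -
          a (n + 1) * b (n + 1 + 1) - a (n + 1 + 1) * b (n + 1)) :=
      Finset.sum_range_succ _ _
    rw [h, ih, Finset.sum_range_succ]
    ring

theorem chainForm_add_smul (n : ℕ) (c t : ℝ) (a b : ℕ → ℝ) :
    chainForm n c (fun i => a i + t * b i) (fun i => a i + t * b i) =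
      chainForm n c a a + 2 * t * chainForm n c a b + t ^ 2 * chainForm n c b b := by
  simp only [chainForm, Finset.mul_sum, ← Finset.sum_add_distrib]
  exact Finset.sum_congr rfl fun i _ => by ring

theorem chainForm_one (n : ℕ) (c : ℝ) (a : ℕ → ℝ) :
    chainForm n c a (fun _ => 1) = (c - 1) * chainSum n a := by
  simp only [chainForm, chainSum, Finset.mul_sum]
  exact Finset.sum_congr rfl fun i _ => by ring

theorem chainSum_add_smul (n : ℕ) (t : ℝ) (a b : ℕ → ℝ) :
    chainSum n (fun i => a i + t * b i) = chainSum n a + t * chainSum n b := by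
  simp only [chainSum, Finset.mul_sum, ← Finset.sum_add_distrib]
  exact Finset.sum_congr rfl fun i _ => by ring

theorem eq_of_chainForm_one_eq_zero {n : ℕ} {a : ℕ → ℝ} (h : chainForm n 1 a a = 0) :
    ∀ i ≤ n + 1, a i = a 0 := by
  have h1 : ∑ i ∈ Finset.range (n + 1), (a i - a (i + 1)) ^ 2 = 0 := by
    rw [← h, chainForm]
    exact Finset.sum_congr rfl fun i _ => by ring
  rw [Finset.sum_eq_zero_iff_of_nonneg fun i _ => sq_nonneg _] at h1
  intro i hi
  induction i with
  | zero => rfl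
  | succ i ih =>
    have := h1 i (by simp; omega)
    rw [← ih (by omega)]
    have := pow_eq_zero_iff (two_ne_zero) |>.mp this
    linarith

theorem chainForm_one_self_nonneg (n : ℕ) (a : ℕ → ℝ) : 0 ≤ chainForm n 1 a a := by
  refine Finset.sum_nonneg fun i _ => ?_
  nlinarith [sq_nonneg (a i - a (i + 1))]

/-! ### The subdivided graph and its forms -/

namespace MetricGraph

variable {V E : Type*}

/-- The vertices of the subdivision of `G` in which each edge is cut into `n + 1` segments: the
`i`-th point of the edge `e`, for `0 ≤ i ≤ n + 1`. -/
def gridPoint (G : MetricGraph V E) (n : ℕ) (e : E) (i : ℕ) : V ⊕ E × Fin n :=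
  if i = 0 then .inl (G.src e)
  else if h : i - 1 < n then .inr (e, ⟨i - 1, h⟩) else .inl (G.tgt e)

@[simp]
theorem gridPoint_zero (G : MetricGraph V E) (n : ℕ) (e : E) :
    G.gridPoint n e 0 = .inl (G.src e) := by simp [gridPoint]

@[simp]
theorem gridPoint_last (G : MetricGraph V E) (n : ℕ) (e : E) :
    G.gridPoint n e (n + 1) = .inl (G.tgt e) := by simp [gridPoint]

theorem gridPoint_succ (G : MetricGraph V E) {n : ℕ} (e : E) {i : ℕ} (hi : i < n) :
    G.gridPoint n e (i + 1) = .inr (e, ⟨i, hi⟩) := by simp [gridPoint, hi]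

/-- The length of the segments of `e` after subdivision. -/
noncomputable def mesh (G : MetricGraph V E) (n : ℕ) (e : E) : ℝ := G.len e / (n + 1)

theorem mesh_pos (G : MetricGraph V E) (n : ℕ) (e : E) : 0 < G.mesh n e :=
  div_pos (G.len_pos e) (by positivity)

theorem mesh_mul (G : MetricGraph V E) (n : ℕ) (e : E) : G.mesh n e * (n + 1) = G.len e := by
  unfold mesh; field_simp

variable [Fintype E]

/-- The polarized quadratic form `∫ u'² - k² ∫ u²` of the function on `G` which solves `u'' = -k² u`
on each segment of the subdivision, in terms of its values at the subdivision points. -/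
noncomputable def gridForm (G : MetricGraph V E) (n : ℕ) (k : ℝ) (x y : V ⊕ E × Fin n → ℝ) : ℝ :=
  ∑ e, 1 / (G.mesh n e * Real.sinc (k * G.mesh n e)) *
    chainForm n (Real.cos (k * G.mesh n e)) (fun i => x (G.gridPoint n e i))
      (fun i => y (G.gridPoint n e i))

/-- The integral of the function on `G` which solves `u'' = -k² u` on each segment of the
subdivision, in terms of its values at the subdivision points. -/
noncomputable def gridIntegral (G : MetricGraph V E) (n : ℕ) (k : ℝ) (x : V ⊕ E × Fin n → ℝ) : ℝ :=
  ∑ e, G.mesh n e / 2 * Real.sinc (k * G.mesh n e / 2) / Real.cos (k * G.mesh n e / 2) *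
    chainSum n (fun i => x (G.gridPoint n e i))

theorem gridForm_add_smul (G : MetricGraph V E) (n : ℕ) (k t : ℝ) (x y : V ⊕ E × Fin n → ℝ) :
    G.gridForm n k (x + t • y) (x + t • y) =
      G.gridForm n k x x + 2 * t * G.gridForm n k x y + t ^ 2 * G.gridForm n k y y := by
  simp only [gridForm, Finset.mul_sum, ← Finset.sum_add_distrib, Pi.add_apply, Pi.smul_apply,
    smul_eq_mul, chainForm_add_smul]
  exact Finset.sum_congr rfl fun i _ => by ring

theorem gridIntegral_add_smul (G : MetricGraph V E) (n : ℕ) (k t : ℝ) (x y : V ⊕ E × Fin n → ℝ) :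
    G.gridIntegral n k (x + t • y) = G.gridIntegral n k x + t * G.gridIntegral n k y := by
  simp only [gridIntegral, Finset.mul_sum, ← Finset.sum_add_distrib, Pi.add_apply, Pi.smul_apply,
    smul_eq_mul, chainSum_add_smul]
  exact Finset.sum_congr rfl fun i _ => by ring

theorem sinc_pos {x : ℝ} (h0 : 0 ≤ x) (h : x < Real.pi) : 0 < Real.sinc x := by
  rcases h0.eq_or_lt with rfl | h0
  · simp
  · rw [Real.sinc_of_ne_zero h0.ne']
    exact div_pos (Real.sin_pos_of_pos_of_lt_pi h0 h) h0

theorem cos_half_pos {x : ℝ} (h0 : 0 ≤ x) (h : x < Real.pi) : 0 < Real.cos (x / 2) :=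
  Real.cos_pos_of_mem_Ioo ⟨by linarith [Real.pi_pos], by linarith⟩

/-- Pairing with a constant turns the form into `-k²` times the integral, by the half-angle identity
`(1 - cos θ) / sin θ = tan (θ / 2)`. Hence kernel vectors have mean zero. -/
theorem gridForm_one (G : MetricGraph V E) (n : ℕ) {k : ℝ} (hk : 0 < k)
    (hn : ∀ e, k * G.mesh n e < Real.pi) (x : V ⊕ E × Fin n → ℝ) :
    G.gridForm n k x 1 = -k ^ 2 * G.gridIntegral n k x := by
  simp only [gridForm, gridIntegral, Finset.mul_sum]
  refine Finset.sum_congr rfl fun e _ => ?_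
  have hm := G.mesh_pos n e
  have hkm : 0 < k * G.mesh n e := mul_pos hk hm
  have hc := (cos_half_pos hkm.le (hn e)).ne'
  have hs : Real.sin (k * G.mesh n e / 2) ≠ 0 :=
    (Real.sin_pos_of_pos_of_lt_pi (by linarith) (by linarith [hn e])).ne'
  rw [show (fun i => (1 : V ⊕ E × Fin n → ℝ) (G.gridPoint n e i)) = fun _ => 1 from rfl,
    chainForm_one, Real.sinc_of_ne_zero hkm.ne',
    Real.sinc_of_ne_zero (show k * G.mesh n e / 2 ≠ 0 by positivity)]
  have h1 : Real.sin (k * G.mesh n e) =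
      2 * Real.sin (k * G.mesh n e / 2) * Real.cos (k * G.mesh n e / 2) := by
    rw [← Real.sin_two_mul]; ring_nf
  have h2 : Real.cos (k * G.mesh n e) = 1 - 2 * Real.sin (k * G.mesh n e / 2) ^ 2 := by
    have := Real.cos_two_mul' (k * G.mesh n e / 2)
    have h3 := Real.sin_sq_add_cos_sq (k * G.mesh n e / 2)
    rw [show 2 * (k * G.mesh n e / 2) = k * G.mesh n e by ring] at this
    linarith
  rw [h1, h2]
  generalize Real.sin (k * G.mesh n e / 2) = s at *
  generalize Real.cos (k * G.mesh n e / 2) = c at *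
  field_simp
  ring

/-- On a segment with both end values `1` the solution has mean `tan x / x ≥ 1`, where `x` is half
of `k * mesh` (read as `1` at `x = 0`). -/
theorem le_gridIntegral_one (G : MetricGraph V E) (n : ℕ) {k : ℝ} (hk : 0 ≤ k)
    (hn : ∀ e, k * G.mesh n e < Real.pi) : ∑ e, G.len e ≤ G.gridIntegral n k 1 := by
  refine Finset.sum_le_sum fun e _ => ?_
  have hm := G.mesh_pos n e
  have hkm : 0 ≤ k * G.mesh n e := mul_nonneg hk hm.le
  have hc := cos_half_pos hkm (hn e)
  have h1 : chainSum n (fun i => (1 : V ⊕ E × Fin n → ℝ) (G.gridPoint n e i)) = 2 * (n + 1) := by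
    simp [chainSum]; ring
  have h2 : Real.cos (k * G.mesh n e / 2) ≤ Real.sinc (k * G.mesh n e / 2) := by
    rcases hkm.eq_or_lt with h | h
    · simp [← h]
    · rw [Real.sinc_of_ne_zero (by positivity), le_div_iff₀ (by positivity)]
      have := Real.le_tan (x := k * G.mesh n e / 2) (by positivity) (by linarith [hn e])
      rw [Real.tan_eq_sin_div_cos, le_div_iff₀ hc] at this
      linarith
  rw [h1, ← G.mesh_mul n e, mul_div_assoc]
  have h3 : 1 ≤ Real.sinc (k * G.mesh n e / 2) / Real.cos (k * G.mesh n e / 2) :=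
    (one_le_div hc).mpr h2
  have h4 : 0 ≤ G.mesh n e * (n + 1) := by positivity
  nlinarith

/-- Discrete Green's formula on the subdivision. -/
theorem gridForm_eq (G : MetricGraph V E) (n : ℕ) (k : ℝ) (x y : V ⊕ E × Fin n → ℝ) :
    G.gridForm n k x y = ∑ e, 1 / (G.mesh n e * Real.sinc (k * G.mesh n e)) *
      ((Real.cos (k * G.mesh n e) * x (.inl (G.src e)) - x (G.gridPoint n e 1)) *
          y (.inl (G.src e)) +
        (Real.cos (k * G.mesh n e) * x (.inl (G.tgt e)) - x (G.gridPoint n e n)) *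
          y (.inl (G.tgt e)) +
        ∑ i ∈ Finset.range n, (2 * Real.cos (k * G.mesh n e) * x (G.gridPoint n e (i + 1)) -
          x (G.gridPoint n e i) - x (G.gridPoint n e (i + 2))) * y (G.gridPoint n e (i + 1))) := by
  simp only [gridForm, chainForm_eq, gridPoint_zero, gridPoint_last]

end MetricGraph
-- Kernel vectors of the form and eigenfunctions
namespace MetricGraph

variable {V E : Type*} [Fintype E]

/-- Green's formula: sampled sines and cosines satisfy the three-term recurrence, so interior grid
points contribute nothing. What remains is `-u'` at the start and `u'` at the end of each edge, for
`u = A cos (k t) + B sin (k t)`. -/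
theorem gridForm_of_trig (G : MetricGraph V E) (n : ℕ) {k : ℝ} (hk : 0 < k)
    (hn : ∀ e, k * G.mesh n e < Real.pi) (x y : V ⊕ E × Fin n → ℝ) (A B : E → ℝ)
    (hx : ∀ e, ∀ i : ℕ, i ≤ n + 1 → x (G.gridPoint n e i) =
      A e * Real.cos (i * (k * G.mesh n e)) + B e * Real.sin (i * (k * G.mesh n e))) :
    G.gridForm n k x y = ∑ e, (-(k * B e) * y (.inl (G.src e)) +
      k * (-A e * Real.sin (k * G.len e) + B e * Real.cos (k * G.len e)) *
        y (.inl (G.tgt e))) := by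
  rw [gridForm_eq]
  refine Finset.sum_congr rfl fun e _ => ?_
  have hm := G.mesh_pos n e
  have hkm : 0 < k * G.mesh n e := mul_pos hk hm
  have hs : Real.sin (k * G.mesh n e) ≠ 0 := (Real.sin_pos_of_pos_of_lt_pi hkm (hn e)).ne'
  have h0 := hx e 0 (by omega)
  have h1 := hx e 1 (by omega)
  have hN := hx e (n + 1) le_rfl
  have hN' := hx e n (by omega)
  have hlen : k * G.len e = n * (k * G.mesh n e) + k * G.mesh n e := by
    rw [← G.mesh_mul n e]; ring
  rw [gridPoint_zero] at h0
  rw [gridPoint_last] at hN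
  have hN2 : ((n + 1 : ℕ) : ℝ) * (k * G.mesh n e) = n * (k * G.mesh n e) + k * G.mesh n e := by
    push_cast; ring
  rw [hN2] at hN
  have hint : ∀ i ∈ Finset.range n, (2 * Real.cos (k * G.mesh n e) * x (G.gridPoint n e (i + 1)) -
      x (G.gridPoint n e i) - x (G.gridPoint n e (i + 2))) * y (G.gridPoint n e (i + 1)) = 0 := by
    intro i hi
    have hi := Finset.mem_range.mp hi
    rw [hx e i (by omega), hx e (i + 1) (by omega), hx e (i + 2) (by omega)]
    have e1 : ((i + 1 : ℕ) : ℝ) * (k * G.mesh n e) = i * (k * G.mesh n e) + k * G.mesh n e := by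
      push_cast; ring
    have e2 : ((i + 2 : ℕ) : ℝ) * (k * G.mesh n e) =
        i * (k * G.mesh n e) + k * G.mesh n e + k * G.mesh n e := by
      push_cast; ring
    rw [e1, e2]
    simp only [Real.cos_add, Real.sin_add]
    have := Real.sin_sq_add_cos_sq (k * G.mesh n e)
    generalize Real.sin (k * G.mesh n e) = s at *
    generalize Real.cos (k * G.mesh n e) = c at *
    generalize Real.sin (i * (k * G.mesh n e)) = s' at *
    generalize Real.cos (i * (k * G.mesh n e)) = c' at *
    linear_combination ((A e * c' + B e * s') * y (G.gridPoint n e (i + 1))) * this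
  rw [Finset.sum_eq_zero hint, h0, h1, hN, hN', Real.sinc_of_ne_zero hkm.ne', hlen]
  simp only [Nat.cast_zero, zero_mul, Real.cos_zero, Real.sin_zero, Nat.cast_one, one_mul,
    Real.cos_add, Real.sin_add]
  have := Real.sin_sq_add_cos_sq (k * G.mesh n e)
  generalize Real.sin (n * (k * G.mesh n e)) = s' at *
  generalize Real.cos (n * (k * G.mesh n e)) = c' at *
  generalize Real.sin (k * G.mesh n e) = s at *
  generalize Real.cos (k * G.mesh n e) = c at *
  have hc : c ^ 2 = 1 - s ^ 2 := by linarith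
  field_simp
  linear_combination (y (.inl (G.tgt e)) * (A e * c' + B e * s')) * hc

theorem sum_mul_comp_eq_sum_fiber [Fintype V] (p : E → V) (f : E → ℝ) (y : V → ℝ) :
    letI := Classical.decEq V
    ∑ e, f e * y (p e) = ∑ v, (∑ e with p e = v, f e) * y v := by
  classical
  simp only [Finset.sum_filter, Finset.sum_mul]
  rw [Finset.sum_comm]
  refine Finset.sum_congr rfl fun e _ => ?_
  simp

/-- The values at the subdivision points of an eigenfunction lie in the kernel of `gridForm`. -/
theorem IsEigenvalue.exists_gridForm_eq_zero [Fintype V] {G : MetricGraph V E} {k : ℝ}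
    (h : G.IsEigenvalue (k ^ 2)) (n : ℕ) (hk : 0 < k) (hn : ∀ e, k * G.mesh n e < Real.pi) :
    ∃ x ≠ 0, ∀ y, G.gridForm n k x y = 0 := by
  obtain ⟨u, ⟨e₀, t₀, ht₀, hu₀⟩, φ, u', hφ, hu, -, hu', hv⟩ := h
  have hcont : ∀ e, ContinuousOn (u e) (Icc 0 (G.len e)) :=
    fun e t ht => (hu e t ht).continuousWithinAt
  have hderiv : ∀ e, ∀ t ∈ Icc 0 (G.len e),
      HasDerivWithinAt (u' e) (-(k ^ 2 * u e t)) (Icc 0 (G.len e)) t := by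
    intro e t ht
    have hc : ContinuousOn (fun s => -(k ^ 2 * u e s)) (Icc 0 (G.len e)) :=
      ((hcont e).const_smul (k ^ 2)).neg
    have hfact : Fact (t ∈ Icc 0 (G.len e)) := ⟨ht⟩
    have hd : HasDerivWithinAt (fun t => ∫ s in (0 : ℝ)..t, -(k ^ 2 * u e s))
        (-(k ^ 2 * u e t)) (Icc 0 (G.len e)) t := by
      refine intervalIntegral.integral_hasDerivWithinAt_right ?_
        (hc.stronglyMeasurableAtFilter_nhdsWithin measurableSet_Icc t) (hc t ht)
      refine (hc.mono ?_).intervalIntegrable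
      rw [uIcc_of_le ht.1]
      exact Icc_subset_Icc_right ht.2
    exact (hd.const_add (u' e 0)).congr (hu' e) (hu' e t ht)
  have hsol := fun e => eq_cos_add_sin_of_hasDerivWithinAt hk.ne' (hu e) (hderiv e)
  have hgrid : ∀ e, ∀ i : ℕ, i ≤ n + 1 → i * G.mesh n e ∈ Icc 0 (G.len e) := by
    intro e i hi
    have hm := G.mesh_pos n e
    refine ⟨by positivity, ?_⟩
    rw [← G.mesh_mul n e, mul_comm]
    exact mul_le_mul_of_nonneg_left (by exact_mod_cast hi) hm.le
  set x : V ⊕ E × Fin n → ℝ :=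
    Sum.elim φ (fun q => u q.1 ((q.2 + 1 : ℕ) * G.mesh n q.1)) with hxdef
  have hxu : ∀ e, ∀ i : ℕ, i ≤ n + 1 → x (G.gridPoint n e i) = u e (i * G.mesh n e) := by
    intro e i hi
    rcases i with _ | i
    · simp [hxdef, (hφ e).1]
    rcases Nat.lt_or_ge i n with h | h
    · rw [gridPoint_succ G e h]
      simp [hxdef]
    · obtain rfl : i = n := by omega
      rw [gridPoint_last, show ((i + 1 : ℕ) : ℝ) * G.mesh i e = G.len e by
        rw [← G.mesh_mul i e]; push_cast; ring]
      simp [hxdef, (hφ e).2]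
  have hxt : ∀ e, ∀ i : ℕ, i ≤ n + 1 → x (G.gridPoint n e i) =
      u e 0 * Real.cos (i * (k * G.mesh n e)) +
        u' e 0 / k * Real.sin (i * (k * G.mesh n e)) := by
    intro e i hi
    rw [hxu e i hi, (hsol e _ (hgrid e i hi)).1]
    congr 3 <;> ring_nf
  refine ⟨x, ?_, fun y => ?_⟩
  -- Vanishing of the first two grid values on `e₀` gives `u 0 = 0` and `u' 0 = 0`, since `sin (k *
  -- mesh) ≠ 0`; then `u` vanishes on all of `e₀`.
  · intro hx0
    have h0 := hxt e₀ 0 (by omega)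
    have h1 := hxt e₀ 1 (by omega)
    have hs : Real.sin (k * G.mesh n e₀) ≠ 0 :=
      (Real.sin_pos_of_pos_of_lt_pi (mul_pos hk (G.mesh_pos n e₀)) (hn e₀)).ne'
    simp only [hx0, Pi.zero_apply, Nat.cast_zero, zero_mul, Real.cos_zero, Real.sin_zero,
      mul_one, mul_zero, add_zero] at h0
    simp only [hx0, Pi.zero_apply, Nat.cast_one, one_mul, ← h0, zero_mul, zero_add] at h1
    have h2 : u' e₀ 0 / k = 0 := (mul_eq_zero.mp h1.symm).resolve_right hs
    apply hu₀
    rw [(hsol e₀ t₀ ht₀).1, ← h0, h2]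
    simp
  · rw [gridForm_of_trig G n hk hn x y _ _ hxt]
    have h1 : ∀ e, (-(k * (u' e 0 / k)) * y (.inl (G.src e)) +
        k * (-u e 0 * Real.sin (k * G.len e) + u' e 0 / k * Real.cos (k * G.len e)) *
        y (.inl (G.tgt e))) = -(u' e 0 * y (.inl (G.src e)) +
          (-u' e (G.len e)) * y (.inl (G.tgt e))) := by
      intro e
      rw [(hsol e _ (right_mem_Icc.mpr (G.len_pos e).le)).2]
      field_simp
      ring
    simp only [h1, Finset.sum_neg_distrib, Finset.sum_add_distrib, neg_eq_zero]
    rw [sum_mul_comp_eq_sum_fiber G.src (fun e => u' e 0) (fun v => y (.inl v)),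
      sum_mul_comp_eq_sum_fiber G.tgt (fun e => -u' e (G.len e)) (fun v => y (.inl v)),
      ← Finset.sum_add_distrib]
    refine Finset.sum_eq_zero fun v _ => ?_
    rw [← add_mul]
    have := hv v
    convert zero_mul (y (.inl v))

/-- A vector in the kernel of `gridForm` comes from an eigenfunction. -/
theorem isEigenvalue_of_gridForm_eq_zero [Fintype V] (G : MetricGraph V E) (n : ℕ) {k : ℝ}
    (hk : 0 < k) (hn : ∀ e, k * G.mesh n e < Real.pi)
    (hsurj : ∀ w, ∃ e, ∃ i ≤ n + 1, G.gridPoint n e i = w)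
    {x : V ⊕ E × Fin n → ℝ} (hx0 : x ≠ 0) (hx : ∀ y, G.gridForm n k x y = 0) :
    G.IsEigenvalue (k ^ 2) := by
  classical
  have hm := G.mesh_pos n
  have hs : ∀ e, Real.sin (k * G.mesh n e) ≠ 0 := fun e =>
    (Real.sin_pos_of_pos_of_lt_pi (mul_pos hk (hm e)) (hn e)).ne'
  have hrec : ∀ e, ∀ i < n, 2 * Real.cos (k * G.mesh n e) * x (G.gridPoint n e (i + 1)) -
      x (G.gridPoint n e i) - x (G.gridPoint n e (i + 2)) = 0 := by
    intro e i hi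
    -- The indicator of an interior grid point isolates the recurrence there.
    have h := hx (Pi.single (.inr (e, ⟨i, hi⟩)) 1)
    rw [gridForm_eq, Finset.sum_eq_single e, Finset.sum_eq_single i] at h
    · have hw : 1 / (G.mesh n e * Real.sinc (k * G.mesh n e)) ≠ 0 := by
        have := sinc_pos (mul_pos hk (hm e)).le (hn e)
        have := hm e
        positivity
      have h := (mul_eq_zero.mp h).resolve_left hw
      simpa [gridPoint_succ G e hi] using h
    · intro j hj hji
      rw [gridPoint_succ G e (Finset.mem_range.mp hj)]
      simp [hji]
    · simp [hi]
    · intro e' _ he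
      simp only [ne_eq, reduceCtorEq, not_false_eq_true, Pi.single_eq_of_ne, mul_zero, add_zero,
        zero_add]
      rw [Finset.sum_eq_zero, mul_zero]
      intro j hj
      rw [gridPoint_succ G e' (Finset.mem_range.mp hj)]
      simp [he]
    · simp
  set A : E → ℝ := fun e => x (.inl (G.src e)) with hA
  -- Fixed by the grid value at index `1`; the recurrence propagates the trigonometric formula from
  -- indices `0` and `1`.
  set B : E → ℝ := fun e => (x (G.gridPoint n e 1) - A e * Real.cos (k * G.mesh n e)) /
    Real.sin (k * G.mesh n e) with hB
  have hxt : ∀ e, ∀ i : ℕ, i ≤ n + 1 → x (G.gridPoint n e i) =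
      A e * Real.cos (i * (k * G.mesh n e)) + B e * Real.sin (i * (k * G.mesh n e)) := by
    intro e i
    induction i using Nat.strong_induction_on with
    | _ i ih =>
      intro hi
      match i, ih, hi with
      | 0, _, _ => simp [hA]
      | 1, _, _ =>
        have := hs e
        simp only [Nat.cast_one, one_mul, hB]
        field_simp
        ring
      | i + 2, ih, hi =>
        have h0 := ih i (by omega) (by omega)
        have h1 := ih (i + 1) (by omega) (by omega)
        have h2 := hrec e i (by omega)
        have e1 : ((i + 1 : ℕ) : ℝ) * (k * G.mesh n e) =
            i * (k * G.mesh n e) + k * G.mesh n e := by push_cast; ring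
        have e2 : ((i + 2 : ℕ) : ℝ) * (k * G.mesh n e) =
            i * (k * G.mesh n e) + k * G.mesh n e + k * G.mesh n e := by push_cast; ring
        rw [e1] at h1
        rw [h0, h1] at h2
        rw [e2]
        simp only [Real.cos_add, Real.sin_add] at h2 ⊢
        have := Real.sin_sq_add_cos_sq (k * G.mesh n e)
        generalize Real.sin (k * G.mesh n e) = s at *
        generalize Real.cos (k * G.mesh n e) = c at *
        generalize Real.sin (i * (k * G.mesh n e)) = s' at *
        generalize Real.cos (i * (k * G.mesh n e)) = c' at *
        linear_combination (A e * c' + B e * s') * this - h2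
  have hlen : ∀ e, ((n + 1 : ℕ) : ℝ) * (k * G.mesh n e) = k * G.len e := by
    intro e; rw [← G.mesh_mul n e]; push_cast; ring
  have hdc : ∀ t, HasDerivAt (fun t => Real.cos (k * t)) (-Real.sin (k * t) * (k * 1)) t :=
    fun t => ((hasDerivAt_id t).const_mul k).cos
  have hds : ∀ t, HasDerivAt (fun t => Real.sin (k * t)) (Real.cos (k * t) * (k * 1)) t :=
    fun t => ((hasDerivAt_id t).const_mul k).sin
  refine ⟨fun e t => A e * Real.cos (k * t) + B e * Real.sin (k * t), ?_, fun v => x (.inl v),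
    fun e t => k * (-A e * Real.sin (k * t) + B e * Real.cos (k * t)), ?_, ?_, ?_, ?_, ?_⟩
  · obtain ⟨w, hw⟩ := Function.ne_iff.mp hx0
    obtain ⟨e, i, hi, rfl⟩ := hsurj w
    refine ⟨e, i * G.mesh n e, ⟨by have := hm e; positivity, ?_⟩, ?_⟩
    · rw [← G.mesh_mul n e, mul_comm]
      exact mul_le_mul_of_nonneg_left (by exact_mod_cast hi) (hm e).le
    · rw [hxt e i hi] at hw
      change A e * Real.cos (k * (i * G.mesh n e)) + B e * Real.sin (k * (i * G.mesh n e)) ≠ 0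
      rw [show k * (i * G.mesh n e) = i * (k * G.mesh n e) by ring]
      exact hw
  · intro e
    have := hxt e (n + 1) le_rfl
    rw [gridPoint_last, hlen] at this
    exact ⟨by simp [hA], this.symm⟩
  · intro e t _
    exact ((((hdc t).const_mul (A e)).add ((hds t).const_mul (B e))).congr_deriv
      (by ring)).hasDerivWithinAt
  · intro e
    have hc : Continuous fun t => -(k ^ 2 * (A e * Real.cos (k * t) + B e * Real.sin (k * t))) := by
      fun_prop
    obtain ⟨M, hM⟩ := (isCompact_Icc (a := 0) (b := G.len e)).exists_bound_of_continuousOn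
      hc.continuousOn
    exact MeasureTheory.MemLp.of_bound hc.aestronglyMeasurable M
      ((MeasureTheory.ae_restrict_iff' measurableSet_Icc).mpr (.of_forall hM))
  · intro e t _
    rw [intervalIntegral.integral_eq_sub_of_hasDerivAt (f := fun t =>
      k * (-A e * Real.sin (k * t) + B e * Real.cos (k * t)))]
    · ring
    · intro t _
      exact ((((hds t).const_mul (-A e)).add ((hdc t).const_mul (B e))).const_mul k).congr_deriv
        (by ring)
    · exact Continuous.intervalIntegrable (by fun_prop) _ _
  · intro v
    -- The indicator of `v` yields the Kirchhoff condition at `v`.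
    have h := hx (Sum.elim (Pi.single v 1) 0)
    rw [gridForm_of_trig G n hk hn x _ _ _ hxt] at h
    simp only [Sum.elim_inl, Finset.sum_add_distrib, Pi.single_apply, mul_ite, mul_one, mul_zero,
      ← Finset.sum_filter] at h
    simp only [mul_zero, Real.sin_zero, Real.cos_zero, zero_add, mul_one,
      Finset.sum_neg_distrib] at h ⊢
    have h2 : ∀ a b : ℝ, -a + b = 0 → a + -b = 0 := fun a b h => by linarith
    exact h2 _ _ (by convert h)

end MetricGraph
-- The variational bound for the spectral gap
namespace MetricGraph

variable {V E : Type*} [Fintype E]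

/-- At `k = 0` the form is a weighted sum of squared differences along segments, so only constants
can be null vectors, and the penalty is positive on nonzero constants. -/
theorem gridForm_self_zero_pos [Nonempty E] (G : MetricGraph V E) (n : ℕ)
    (hconn : ∀ x : V ⊕ E × Fin n → ℝ,
      (∀ e, ∀ i ≤ n + 1, x (G.gridPoint n e i) = x (G.gridPoint n e 0)) → ∃ c, ∀ w, x w = c)
    {C : ℝ} (hC : 0 < C) {x : V ⊕ E × Fin n → ℝ} (hx : x ≠ 0) :
    0 < G.gridForm n 0 x x + C * G.gridIntegral n 0 x ^ 2 := by
  have hterm : ∀ e, 0 ≤ 1 / (G.mesh n e * Real.sinc (0 * G.mesh n e)) *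
      chainForm n (Real.cos (0 * G.mesh n e)) (fun i => x (G.gridPoint n e i))
        (fun i => x (G.gridPoint n e i)) := by
    intro e
    have := G.mesh_pos n e
    simp only [zero_mul, Real.cos_zero, Real.sinc_zero]
    exact mul_nonneg (by positivity) (chainForm_one_self_nonneg _ _)
  have h0 : 0 ≤ G.gridForm n 0 x x := Finset.sum_nonneg fun e _ => hterm e
  by_contra! hle
  have hsq : 0 ≤ C * G.gridIntegral n 0 x ^ 2 := by positivity
  have hform : G.gridForm n 0 x x = 0 := by linarith
  have hint : G.gridIntegral n 0 x = 0 := by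
    have : C * G.gridIntegral n 0 x ^ 2 = 0 := by linarith
    simpa [hC.ne'] using this
  rw [gridForm, Finset.sum_eq_zero_iff_of_nonneg fun e _ => hterm e] at hform
  obtain ⟨c, hc⟩ := hconn x fun e i hi => by
    have h := hform e (Finset.mem_univ e)
    simp only [zero_mul, Real.cos_zero, Real.sinc_zero] at h
    have h := (mul_eq_zero.mp h).resolve_left (by have := G.mesh_pos n e; positivity)
    exact eq_of_chainForm_one_eq_zero h i hi
  obtain rfl : x = (0 : V ⊕ E × Fin n → ℝ) + c • 1 := by
    ext w; simp [hc w]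
  rw [gridIntegral_add_smul, show G.gridIntegral n 0 0 = 0 by simp [gridIntegral, chainSum],
    zero_add] at hint
  have h1 := G.le_gridIntegral_one n le_rfl (fun e => by simpa using Real.pi_pos)
  have h2 : 0 < ∑ e, G.len e :=
    Finset.sum_pos (fun e _ => G.len_pos e) Finset.univ_nonempty
  have hc0 : c = 0 := (mul_eq_zero.mp hint).resolve_right (by linarith)
  apply hx
  simp [hc0]

/-- If the form `∫ u'² - K² ∫ u²` is nonpositive on `u + c` for a nonconstant `u` and all constants
`c`, then the spectral gap is a minimum and at most `K²`. -/
theorem isLeast_spectralGap_of_gridForm_nonpos [Fintype V] [Nonempty E] (G : MetricGraph V E)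
    (n : ℕ) {K : ℝ} (hK : 0 < K) (hn : ∀ e, K * G.mesh n e < Real.pi)
    (hsurj : ∀ w, ∃ e, ∃ i ≤ n + 1, G.gridPoint n e i = w)
    (hconn : ∀ x : V ⊕ E × Fin n → ℝ,
      (∀ e, ∀ i ≤ n + 1, x (G.gridPoint n e i) = x (G.gridPoint n e 0)) → ∃ c, ∀ w, x w = c)
    (u : V ⊕ E × Fin n → ℝ) (hu : ¬ ∃ c, ∀ w, u w = c)
    (hneg : ∀ c : ℝ, G.gridForm n K (u + c • 1) (u + c • 1) ≤ 0) :
    IsLeast {μ : ℝ | 0 < μ ∧ G.IsEigenvalue μ} G.spectralGap ∧ G.spectralGap ≤ K ^ 2 := by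
  have hL : 0 < ∑ e, G.len e :=
    Finset.sum_pos (fun e _ => G.len_pos e) Finset.univ_nonempty
  have hm := G.mesh_pos n
  have hlt : ∀ k ∈ Icc 0 K, ∀ e, k * G.mesh n e < Real.pi := fun k hk e =>
    (mul_le_mul_of_nonneg_right hk.2 (hm e).le).trans_lt (hn e)
  -- Large enough that `C * ∫ 1 > k²` for every `k ≤ K`; this keeps the penalty from creating
  -- spurious degeneracies.
  set C : ℝ := (K ^ 2 + 1) / ∑ e, G.len e with hC
  have hCpos : 0 < C := by positivity
  have hC1 : ∀ k ∈ Icc 0 K, k ^ 2 < C * G.gridIntegral n k 1 := by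
    intro k hk
    have h1 := mul_le_mul_of_nonneg_left (G.le_gridIntegral_one n hk.1 (hlt k hk)) hCpos.le
    have h2 : C * ∑ e, G.len e = K ^ 2 + 1 := div_mul_cancel₀ _ hL.ne'
    have h3 : k ^ 2 ≤ K ^ 2 := pow_le_pow_left₀ hk.1 hk.2 2
    linarith
  set F : ℝ → (V ⊕ E × Fin n → ℝ) → (V ⊕ E × Fin n → ℝ) → ℝ := fun k x y =>
    G.gridForm n k x y + C * (G.gridIntegral n k x * G.gridIntegral n k y) with hF
  have hadd : ∀ k x y (t : ℝ), F k (x + t • y) (x + t • y) =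
      F k x x + 2 * t * F k x y + t ^ 2 * F k y y := by
    intro k x y t
    simp only [hF, gridForm_add_smul, gridIntegral_add_smul]
    ring
  have hI0 : ∀ k, G.gridIntegral n k 0 = 0 := fun k => by simp [gridIntegral, chainSum]
  have hQ0 : ∀ k y, G.gridForm n k 0 y = 0 := fun k y => by simp [gridForm, chainForm]
  have hsmul : ∀ k x (t : ℝ), F k (t • x) (t • x) = t ^ 2 * F k x x := by
    intro k x t
    have := hadd k 0 x t
    have h0 : ∀ y, F k 0 y = 0 := fun y => by simp [hF, hI0, hQ0]
    simpa [h0] using this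
  have hcont : ContinuousOn (fun q : ℝ × (V ⊕ E × Fin n → ℝ) => F q.1 q.2 q.2)
      (Icc 0 K ×ˢ univ) := by
    -- Writing the coefficients with `sinc` instead of `sin (k m) / k` makes them continuous at `k =
    -- 0`.
    have hsinc : ∀ a : ℝ, Continuous fun q : ℝ × (V ⊕ E × Fin n → ℝ) => Real.sinc (q.1 * a) :=
      fun a => Real.continuous_sinc.comp (by fun_prop)
    have hsinc' : ∀ a : ℝ, Continuous fun q : ℝ × (V ⊕ E × Fin n → ℝ) =>
        Real.sinc (q.1 * a / 2) := fun a => Real.continuous_sinc.comp (by fun_prop)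
    have hI : ContinuousOn (fun q : ℝ × (V ⊕ E × Fin n → ℝ) => G.gridIntegral n q.1 q.2)
        (Icc 0 K ×ˢ univ) := by
      unfold gridIntegral chainSum
      refine continuousOn_finsetSum _ fun e _ => ContinuousOn.mul (ContinuousOn.div ?_ ?_ ?_) ?_
      · exact ((hsinc' _).const_smul (G.mesh n e / 2)).continuousOn
      · fun_prop
      · exact fun q hq =>
          (cos_half_pos (mul_nonneg hq.1.1 (hm e).le) (hlt q.1 hq.1 e)).ne'
      · fun_prop
    refine ContinuousOn.add ?_ ((hI.mul hI).const_smul C)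
    unfold gridForm chainForm
    refine continuousOn_finsetSum _ fun e _ => ContinuousOn.mul (ContinuousOn.div ?_ ?_ ?_) ?_
    · fun_prop
    · exact ((hsinc _).const_smul (G.mesh n e)).continuousOn
    · exact fun q hq => (mul_pos (hm e)
        (sinc_pos (mul_nonneg hq.1.1 (hm e).le) (hlt q.1 hq.1 e))).ne'
    · fun_prop
  have hzero : ∀ x ≠ 0, 0 < F 0 x x := by
    intro x hx
    have := G.gridForm_self_zero_pos n hconn hCpos hx
    simpa [hF, sq] using this
  have hbad : ∃ x ≠ 0, F K x x ≤ 0 := by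
    have h1 : G.gridIntegral n K 1 ≠ 0 := by
      have := G.le_gridIntegral_one n hK.le hn
      linarith
    -- This shift makes the integral zero, so the penalty disappears.
    set c := -(G.gridIntegral n K u / G.gridIntegral n K 1) with hc
    refine ⟨u + c • 1, fun h => hu ⟨-c, fun w => ?_⟩, ?_⟩
    · have := congrFun h w
      simp at this
      linarith
    · have h2 : G.gridIntegral n K (u + c • 1) = 0 := by
        rw [gridIntegral_add_smul, hc]
        field_simp
        ring
      simp only [hF, h2, mul_zero, add_zero]
      exact hneg c
  obtain ⟨k, hk, ⟨x, hx0, hx⟩, hpos⟩ :=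
    exists_first_degenerate F hadd hsmul hcont hzero hK.le hbad
  have hkI : k ∈ Icc 0 K := Ioc_subset_Icc_self hk
  -- Testing with `1` gives `(C * ∫ 1 - k²) * ∫ x = 0`, and the first factor is positive. So the
  -- penalty drops out and `x` is in the kernel of `gridForm` itself.
  have hIx : G.gridIntegral n k x = 0 := by
    have h := hx 1
    simp only [hF] at h
    rw [G.gridForm_one n hk.1 (hlt k hkI)] at h
    have h2 : G.gridIntegral n k x * (C * G.gridIntegral n k 1 - k ^ 2) = 0 := by linarith
    exact (mul_eq_zero.mp h2).resolve_right (sub_pos.mpr (hC1 k hkI)).ne'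
  have heig : G.IsEigenvalue (k ^ 2) :=
    G.isEigenvalue_of_gridForm_eq_zero n hk.1 (hlt k hkI) hsurj hx0 fun y => by
      simpa [hF, hIx] using hx y
  have hleast : IsLeast {μ : ℝ | 0 < μ ∧ G.IsEigenvalue μ} (k ^ 2) := by
    -- A smaller positive eigenvalue `j²` would give a nonzero kernel vector of mean zero, on which
    -- the penalized form vanishes although `j < k`.
    refine ⟨⟨pow_pos hk.1 2, heig⟩, fun μ ⟨hμ, hμe⟩ => ?_⟩
    by_contra! hlt'
    set j := √μ with hj
    have hj0 : 0 < j := Real.sqrt_pos.mpr hμ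
    have hjμ : j ^ 2 = μ := Real.sq_sqrt hμ.le
    have hjk : j < k := lt_of_pow_lt_pow_left₀ 2 hk.1.le (by rwa [hjμ])
    have hjI : j ∈ Icc 0 K := ⟨hj0.le, hjk.le.trans hk.2⟩
    rw [← hjμ] at hμe
    obtain ⟨z, hz0, hz⟩ := hμe.exists_gridForm_eq_zero n hj0 (hlt j hjI)
    have hIz : G.gridIntegral n j z = 0 := by
      have h := hz 1
      rw [G.gridForm_one n hj0 (hlt j hjI)] at h
      exact (mul_eq_zero.mp h).resolve_left (neg_ne_zero.mpr (pow_pos hj0 2).ne')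
    have := hpos j ⟨hj0.le, hjk⟩ z hz0
    simp [hF, hz, hIz] at this
  have hgap : G.spectralGap = k ^ 2 := hleast.csInf_eq
  rw [hgap]
  exact ⟨hleast, pow_le_pow_left₀ hk.1.le hk.2 2⟩

end MetricGraph

/-! ### Trigonometric test functions -/

/-- For `c = cos θ` the cosine part has zero energy and zero trapezoidal sum, both by telescoping to
multiples of `sin ((n + 1) θ) = 0`. So the cross term with `m` vanishes and only the nonpositive
energy of the constant remains. Lowering `c` lowers the form. -/
theorem chainForm_cos_nonpos {n : ℕ} {c θ m d : ℝ} {a : ℕ → ℝ}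
    (ha : ∀ i ≤ n + 1, a i = m + d * Real.cos (i * θ)) (hθ0 : 0 < θ) (hθ : θ < Real.pi)
    (hsin : Real.sin ((n + 1 : ℕ) * θ) = 0) (hc : c ≤ Real.cos θ) : chainForm n c a a ≤ 0 := by
  have hs : Real.sin θ ≠ 0 := (Real.sin_pos_of_pos_of_lt_pi hθ0 hθ).ne'
  have hmul : ∀ i : ℕ, ((i + 1 : ℕ) : ℝ) * θ = i * θ + θ := fun i => by push_cast; ring
  have hform : chainForm n (Real.cos θ) (fun i => Real.cos (i * θ))
      (fun i => Real.cos (i * θ)) = 0 := by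
    have h : ∀ i ∈ Finset.range (n + 1), Real.cos θ * (Real.cos (i * θ) * Real.cos (i * θ) +
        Real.cos ((i + 1 : ℕ) * θ) * Real.cos ((i + 1 : ℕ) * θ)) -
        Real.cos (i * θ) * Real.cos ((i + 1 : ℕ) * θ) -
        Real.cos ((i + 1 : ℕ) * θ) * Real.cos (i * θ) =
        (fun i : ℕ => Real.sin θ * Real.sin (i * θ) * Real.cos (i * θ)) i -
          (fun i : ℕ => Real.sin θ * Real.sin (i * θ) * Real.cos (i * θ)) (i + 1) := by
      intro i _
      simp only [hmul, Real.cos_add, Real.sin_add]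
      have := Real.sin_sq_add_cos_sq θ
      generalize Real.sin θ = s at *
      generalize Real.cos θ = c at *
      generalize Real.sin (i * θ) = s' at *
      generalize Real.cos (i * θ) = c' at *
      linear_combination (c * c' * c' - s * s' * c') * this
    rw [chainForm, Finset.sum_congr rfl h, Finset.sum_range_sub', hsin]
    simp
  have hsum : chainSum n (fun i => Real.cos (i * θ)) = 0 := by
    have h : ∀ i ∈ Finset.range (n + 1), Real.sin θ *
        (Real.cos (i * θ) + Real.cos ((i + 1 : ℕ) * θ)) =
        (fun i : ℕ => (1 + Real.cos θ) * Real.sin (i * θ)) (i + 1) -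
          (fun i : ℕ => (1 + Real.cos θ) * Real.sin (i * θ)) i := by
      intro i _
      simp only [hmul, Real.cos_add, Real.sin_add]
      have := Real.sin_sq_add_cos_sq θ
      generalize Real.sin θ = s at *
      generalize Real.cos θ = c at *
      linear_combination (-Real.sin (i * θ)) * this
    have h2 : Real.sin θ * chainSum n (fun i => Real.cos (i * θ)) = 0 := by
      rw [chainSum, Finset.mul_sum, Finset.sum_congr rfl h,
        Finset.sum_range_sub (fun i : ℕ => (1 + Real.cos θ) * Real.sin (i * θ)), hsin]
      simp
    exact (mul_eq_zero.mp h2).resolve_left hs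
  have h1 : chainForm n c a a ≤ chainForm n (Real.cos θ) a a := by
    refine Finset.sum_le_sum fun i _ => ?_
    nlinarith [mul_self_nonneg (a i), mul_self_nonneg (a (i + 1))]
  have h2 : chainForm n (Real.cos θ) a a = chainForm n (Real.cos θ)
      (fun i => m + d * Real.cos (i * θ)) (fun i => m + d * Real.cos (i * θ)) := by
    refine Finset.sum_congr rfl fun i hi => ?_
    have hi := Finset.mem_range.mp hi
    rw [ha i (by omega), ha (i + 1) (by omega)]
  have h3 : chainForm n (Real.cos θ) (fun _ => m) (fun i => Real.cos (i * θ)) =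
      m * (Real.cos θ - 1) * chainSum n (fun i => Real.cos (i * θ)) := by
    simp only [chainForm, chainSum, Finset.mul_sum]
    exact Finset.sum_congr rfl fun i _ => by ring
  have h4 : chainForm n (Real.cos θ) (fun _ => m) (fun _ => m) ≤ 0 := by
    refine Finset.sum_nonpos fun i _ => ?_
    nlinarith [mul_self_nonneg m, Real.cos_le_one θ]
  rw [h2, chainForm_add_smul n (Real.cos θ) d (fun _ => m) (fun i => Real.cos (i * θ)), h3, hsum,
    hform] at h1
  linarith

theorem chainForm_const_nonpos {n : ℕ} {c m : ℝ} {a : ℕ → ℝ} (ha : ∀ i ≤ n + 1, a i = m)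
    (hc : c ≤ 1) : chainForm n c a a ≤ 0 := by
  refine Finset.sum_nonpos fun i hi => ?_
  have hi := Finset.mem_range.mp hi
  rw [ha i (by omega), ha (i + 1) (by omega)]
  nlinarith [mul_self_nonneg m]

/-! ### Connectedness and test functions on the graph -/

namespace MetricGraph

variable {V E : Type*}

/-- A function of the vertices which is constant along each edge is constant. -/
theorem Connected.eq_of_forall_edge {G : MetricGraph V E} (hG : G.Connected) {α : Type*}
    {f : V → α} (hf : ∀ e, f (G.src e) = f (G.tgt e)) (v w : V) : f v = f w := by
  set g : G.Point → α := fun x => match x with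
    | .vertex v => f v
    | .inner e _ _ => f (G.src e) with hg
  have hedge : ∀ x e s, G.OnEdge x e s → g x = f (G.src e) := by
    intro x e s h
    cases x with
    | vertex v =>
      rcases h with ⟨-, h⟩ | ⟨-, h⟩
      · simp [hg, h]
      · simp [hg, hf e, h]
    | inner e' t ht => simp [hg, h.1]
  obtain ⟨c, hc⟩ := hG (.vertex v) (.vertex w)
  have : ∀ x y c, G.IsPathLength x y c → g x = g y := by
    intro x y c h
    induction h with
    | nil x => rfl
    | cons hx hy _ ih => rw [hedge _ _ _ hx, ← hedge _ _ _ hy, ih]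
  exact this _ _ _ hc

theorem Connected.exists_edge_of_ne {G : MetricGraph V E} (hG : G.Connected) {v w : V}
    (hvw : v ≠ w) : ∃ e, G.src e = v ∨ G.tgt e = v := by
  classical
  by_contra! h
  have := hG.eq_of_forall_edge (f := fun u => decide (u = v))
    (fun e => by simp [(h e).1, (h e).2]) w v
  simp at this
  exact hvw this.symm

theorem Connected.exists_gridPoint_eq {G : MetricGraph V E} (hG : G.Connected) [Nontrivial V]
    (n : ℕ) (w : V ⊕ E × Fin n) : ∃ e, ∃ i ≤ n + 1, G.gridPoint n e i = w := by
  rcases w with v | ⟨e, j⟩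
  · obtain ⟨v', hv'⟩ := exists_ne v
    obtain ⟨e, he | he⟩ := hG.exists_edge_of_ne hv'.symm
    · exact ⟨e, 0, by omega, by simp [he]⟩
    · exact ⟨e, n + 1, le_rfl, by simp [he]⟩
  · exact ⟨e, j + 1, by omega, by simp [gridPoint_succ G e j.2]⟩

/-- The bound on the spectral gap obtained from the test function which on the edge `e`, after
rescaling to `[0, 1]`, is `m e + d e * cos (ω e * s)`. -/
theorem isLeast_spectralGap_of_test [Fintype V] [Fintype E] [Nontrivial V] {G : MetricGraph V E}
    (hG : G.Connected) {K : ℝ} (hK : 0 < K) (σ : V → ℝ) (m d ω : E → ℝ)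
    (hsrc : ∀ e, σ (G.src e) = m e + d e) (htgt : ∀ e, σ (G.tgt e) = m e + d e * Real.cos (ω e))
    (hω0 : ∀ e, 0 < ω e) (hsin : ∀ e, Real.sin (ω e) = 0)
    (hω : ∀ e, d e ≠ 0 → ω e ≤ K * G.len e) (hd : ∃ e, d e ≠ 0) :
    IsLeast {μ : ℝ | 0 < μ ∧ G.IsEigenvalue μ} G.spectralGap ∧ G.spectralGap ≤ K ^ 2 := by
  have : Nonempty E := ⟨hd.choose⟩
  -- The total length bounds every edge, so this `n` brings all segments below the threshold `π /
  -- K`.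
  obtain ⟨n, hn⟩ := exists_nat_gt (K * (∑ e, G.len e) / Real.pi)
  have hmesh : ∀ e, K * G.mesh n e < Real.pi := by
    intro e
    rw [div_lt_iff₀ Real.pi_pos] at hn
    have h1 : G.len e ≤ ∑ e, G.len e :=
      Finset.single_le_sum (fun e _ => (G.len_pos e).le) (Finset.mem_univ e)
    have h2 := mul_le_mul_of_nonneg_left h1 hK.le
    rw [mesh, ← mul_div_assoc, div_lt_iff₀ (by positivity)]
    nlinarith [Real.pi_pos]
  set u : V ⊕ E × Fin n → ℝ := Sum.elim σ (fun q => m q.1 + d q.1 *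
    Real.cos ((q.2 + 1 : ℕ) * (ω q.1 / (n + 1)))) with hu
  have hN : ∀ e, ((n + 1 : ℕ) : ℝ) * (ω e / (n + 1)) = ω e := fun e => by
    push_cast; field_simp
  have hug : ∀ e, ∀ i ≤ n + 1,
      u (G.gridPoint n e i) = m e + d e * Real.cos (i * (ω e / (n + 1))) := by
    intro e i hi
    rcases i with _ | i
    · simp [hu, hsrc e]
    rcases Nat.lt_or_ge i n with h | h
    · rw [gridPoint_succ G e h]
      simp [hu]
    · obtain rfl : i = n := by omega
      rw [gridPoint_last, hN]
      simp [hu, htgt e]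
  have hθ : ∀ e, d e ≠ 0 → ω e / (n + 1) ≤ K * G.mesh n e := fun e he => by
    rw [mesh, ← mul_div_assoc]
    exact div_le_div_of_nonneg_right (hω e he) (by positivity)
  refine G.isLeast_spectralGap_of_gridForm_nonpos n hK hmesh (hG.exists_gridPoint_eq n) ?_ u ?_ ?_
  · intro x hx
    obtain ⟨v₀⟩ : Nonempty V := inferInstance
    have hconst : ∀ v, x (.inl v) = x (.inl v₀) := fun v =>
      hG.eq_of_forall_edge (f := fun v => x (.inl v)) (fun e => by
        have := hx e (n + 1) le_rfl
        simp only [gridPoint_last, gridPoint_zero] at this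
        exact this.symm) v v₀
    refine ⟨x (.inl v₀), fun w => ?_⟩
    obtain ⟨e, i, hi, rfl⟩ := hG.exists_gridPoint_eq n w
    rw [hx e i hi, gridPoint_zero, hconst]
  · rintro ⟨c, hc⟩
    obtain ⟨e, he⟩ := hd
    have h0 := hug e 0 (by omega)
    have h1 := hug e 1 (by omega)
    have hpos : 0 < ω e / (n + 1) := div_pos (hω0 e) (by positivity)
    -- The first two grid values differ on an edge with `d e ≠ 0`, because the step angle lies
    -- strictly between `0` and `π`.
    have hcos : Real.cos (ω e / (n + 1)) < Real.cos 0 :=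
      Real.cos_lt_cos_of_nonneg_of_le_pi le_rfl ((hθ e he).trans (hmesh e).le) hpos
    rw [Real.cos_zero] at hcos
    simp only [hc, Nat.cast_zero, zero_mul, Real.cos_zero, Nat.cast_one, one_mul] at h0 h1
    have : d e * (1 - Real.cos (ω e / (n + 1))) = 0 := by linarith
    rcases mul_eq_zero.mp this with h | h
    · exact he h
    · linarith
  · intro c
    refine Finset.sum_nonpos fun e _ => ?_
    have hm := G.mesh_pos n e
    have hkm : 0 < K * G.mesh n e := mul_pos hK hm
    have hs := sinc_pos hkm.le (hmesh e)
    refine mul_nonpos_of_nonneg_of_nonpos (by positivity) ?_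
    have ha : ∀ i ≤ n + 1, (u + c • 1) (G.gridPoint n e i) =
        (m e + c) + d e * Real.cos (i * (ω e / (n + 1))) := fun i hi => by
      simp only [Pi.add_apply, hug e i hi, Pi.smul_apply, Pi.one_apply, smul_eq_mul]
      ring
    by_cases hde : d e = 0
    · refine chainForm_const_nonpos (m := m e + c) (fun i hi => ?_) (Real.cos_le_one _)
      rw [ha i hi, hde]
      ring
    · have hpos : 0 < ω e / (n + 1) := div_pos (hω0 e) (by positivity)
      refine chainForm_cos_nonpos ha hpos ((hθ e hde).trans_lt (hmesh e)) ?_ ?_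
      · rw [hN, hsin]
      · exact Real.cos_le_cos_of_nonneg_of_le_pi hpos.le (hmesh e).le (hθ e hde)

/-- If all edges between a set of vertices and its complement have length at least `L`, then
`λ₁ ≤ π² / L²`. -/
theorem isLeast_spectralGap_of_cut [Fintype V] [Fintype E] [Nontrivial V] {G : MetricGraph V E}
    (hG : G.Connected) {L : ℝ} (hL : 0 < L) {A : Set V} (hA : A.Nonempty) (hA' : Aᶜ.Nonempty)
    (hcut : ∀ e, ¬ (G.src e ∈ A ↔ G.tgt e ∈ A) → L ≤ G.len e) :
    IsLeast {μ : ℝ | 0 < μ ∧ G.IsEigenvalue μ} G.spectralGap ∧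
      G.spectralGap ≤ (Real.pi / L) ^ 2 := by
  classical
  set σ : V → ℝ := fun v => if v ∈ A then 1 else -1 with hσ
  refine isLeast_spectralGap_of_test hG (div_pos Real.pi_pos hL) σ
    (fun e => (σ (G.src e) + σ (G.tgt e)) / 2) (fun e => (σ (G.src e) - σ (G.tgt e)) / 2)
    (fun _ => Real.pi) (fun e => by ring) (fun e => by rw [Real.cos_pi]; ring)
    (fun _ => Real.pi_pos) (fun _ => Real.sin_pi) (fun e he => ?_) ?_
  · have h : L ≤ G.len e := hcut e fun h => he (by simp [hσ, h])
    rw [div_mul_eq_mul_div, le_div_iff₀ hL]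
    exact mul_le_mul_of_nonneg_left h Real.pi_pos.le
  -- If no edge crossed the cut, `σ` would be constant by connectedness.
  · by_contra! h
    obtain ⟨v, hv⟩ := hA
    obtain ⟨w, hw⟩ := hA'
    have := hG.eq_of_forall_edge (f := σ) (fun e => by have := h e; linarith) v w
    simp only [hσ, hv, if_true, if_neg hw] at this
    norm_num at this

/-- If some edge has length at least `2 L`, then `λ₁ ≤ π² / L²`. -/
theorem isLeast_spectralGap_of_edge [Fintype V] [Fintype E] [Nontrivial V] {G : MetricGraph V E}
    (hG : G.Connected) {L : ℝ} (hL : 0 < L) {e₀ : E} (he₀ : 2 * L ≤ G.len e₀) :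
    IsLeast {μ : ℝ | 0 < μ ∧ G.IsEigenvalue μ} G.spectralGap ∧
      G.spectralGap ≤ (Real.pi / L) ^ 2 := by
  classical
  refine isLeast_spectralGap_of_test hG (div_pos Real.pi_pos hL) (fun _ => 1)
    (fun e => if e = e₀ then 0 else 1) (fun e => if e = e₀ then 1 else 0)
    (fun _ => 2 * Real.pi) (fun e => by split_ifs <;> simp)
    (fun e => by split_ifs <;> simp)
    (fun _ => by positivity) (fun _ => Real.sin_two_pi) (fun e he => ?_) ⟨e₀, by simp⟩
  obtain rfl : e = e₀ := by by_contra h; simp [h] at he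
  rw [div_mul_eq_mul_div, le_div_iff₀ hL]
  nlinarith [Real.pi_pos]

end MetricGraph
-- Paths, distances and short edges
namespace MetricGraph

variable {V E : Type*}

theorem IsPathLength.nonneg {G : MetricGraph V E} {x y : G.Point} {c : ℝ}
    (h : G.IsPathLength x y c) : 0 ≤ c := by
  induction h with
  | nil => exact le_rfl
  | cons _ _ _ ih => positivity

theorem IsPathLength.trans {G : MetricGraph V E} {x y z : G.Point} {c d : ℝ}
    (h : G.IsPathLength x y c) (h' : G.IsPathLength y z d) : G.IsPathLength x z (c + d) := by
  induction h with
  | nil => simpa using h'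
  | cons hx hy _ ih => rw [add_assoc]; exact .cons hx hy (ih h')

theorem IsPathLength.of_onEdge {G : MetricGraph V E} {x y : G.Point} {e : E} {s t : ℝ}
    (hx : G.OnEdge x e s) (hy : G.OnEdge y e t) : G.IsPathLength x y |s - t| := by
  simpa using IsPathLength.cons hx hy (.nil y)

theorem dist_le_of_isPathLength {G : MetricGraph V E} {x y : G.Point} {c : ℝ}
    (h : G.IsPathLength x y c) : G.dist x y ≤ c :=
  csInf_le ⟨0, fun _ h => IsPathLength.nonneg h⟩ h

theorem onEdge_src (G : MetricGraph V E) (e : E) : G.OnEdge (.vertex (G.src e)) e 0 :=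
  .inl ⟨rfl, rfl⟩

theorem onEdge_tgt (G : MetricGraph V E) (e : E) : G.OnEdge (.vertex (G.tgt e)) e (G.len e) :=
  .inr ⟨rfl, rfl⟩

/-- Every point is within half an edge length of a vertex. -/
theorem exists_vertex_near (G : MetricGraph V E) {M : ℝ} (hM0 : 0 ≤ M) (hM : ∀ e, G.len e ≤ M)
    (x : G.Point) : ∃ v c, c ≤ M / 2 ∧ G.IsPathLength x (.vertex v) c ∧
      G.IsPathLength (.vertex v) x c := by
  cases x with
  | vertex v => exact ⟨v, 0, by linarith, .nil _, .nil _⟩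
  | inner e t ht =>
    have hx : G.OnEdge (.inner e t ht) e t := ⟨rfl, rfl⟩
    have := hM e
    rcases le_total t (G.len e / 2) with h | h
    · refine ⟨G.src e, |t - 0|, ?_, .of_onEdge hx (G.onEdge_src e), ?_⟩
      · rw [sub_zero, abs_of_pos ht.1]; linarith
      · rw [abs_sub_comm]; exact .of_onEdge (G.onEdge_src e) hx
    · refine ⟨G.tgt e, |t - G.len e|, ?_, .of_onEdge hx (G.onEdge_tgt e), ?_⟩
      · rw [abs_of_neg (by linarith [ht.2])]; linarith
      · rw [abs_sub_comm]; exact .of_onEdge (G.onEdge_tgt e) hx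

/-- If every cut is crossed by an edge of length at most `L`, then any two vertices are joined by
a path of length at most `(|V| - 1) L`. -/
theorem exists_isPathLength_le_of_cut [Fintype V] (G : MetricGraph V E) {L : ℝ} (hL : 0 ≤ L)
    (hcut : ∀ A : Set V, A.Nonempty → Aᶜ.Nonempty →
      ∃ e, ¬ (G.src e ∈ A ↔ G.tgt e ∈ A) ∧ G.len e ≤ L) (v w : V) :
    ∃ c ≤ ((Fintype.card V : ℝ) - 1) * L, G.IsPathLength (.vertex v) (.vertex w) c := by
  classical
  -- The graph of short edges. It is connected: the set reachable from `v` would otherwise be a cut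
  -- crossed by no short edge.
  set H : SimpleGraph V := SimpleGraph.fromRel fun v w =>
    ∃ e, G.src e = v ∧ G.tgt e = w ∧ G.len e ≤ L with hH
  have hreach : H.Reachable v w := by
    by_contra hw
    obtain ⟨e, he, hle⟩ := hcut {w | H.Reachable v w} ⟨v, .refl v⟩ ⟨w, hw⟩
    have hne : G.src e ≠ G.tgt e := fun h => he (by rw [h])
    have hadj : H.Adj (G.src e) (G.tgt e) := ⟨hne, .inl ⟨e, rfl, rfl, hle⟩⟩
    exact he ⟨fun h => h.trans hadj.reachable, fun h => h.trans hadj.symm.reachable⟩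
  have hwalk : ∀ {a b : V} (p : H.Walk a b), ∃ c ≤ (p.length : ℝ) * L,
      G.IsPathLength (.vertex a) (.vertex b) c := by
    intro a b p
    induction p with
    | nil => exact ⟨0, by simp, .nil _⟩
    | cons h p ih =>
      obtain ⟨c, hc, hp⟩ := ih
      rw [SimpleGraph.Walk.length_cons]
      push_cast
      obtain ⟨-, ⟨e, rfl, rfl, he⟩ | ⟨e, rfl, rfl, he⟩⟩ := h
      · refine ⟨|0 - G.len e| + c, ?_, .cons (G.onEdge_src e) (G.onEdge_tgt e) hp⟩
        rw [zero_sub, abs_neg, abs_of_pos (G.len_pos e)]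
        linarith
      · refine ⟨|G.len e - 0| + c, ?_, .cons (G.onEdge_tgt e) (G.onEdge_src e) hp⟩
        rw [sub_zero, abs_of_pos (G.len_pos e)]
        linarith
  -- A walk without repeated vertices has at most `|V| - 1` edges.
  obtain ⟨p, hp⟩ := hreach.exists_isPath
  obtain ⟨c, hc, hc'⟩ := hwalk p
  refine ⟨c, hc.trans (mul_le_mul_of_nonneg_right ?_ hL), hc'⟩
  have : p.length + 1 ≤ Fintype.card V := hp.length_lt
  have : (p.length : ℝ) + 1 ≤ Fintype.card V := by exact_mod_cast this
  linarith

/-- Each end costs at most `M / 2` to reach a vertex; the vertices are then joined through short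
edges. -/
theorem dist_le_of_cut [Fintype V] (G : MetricGraph V E) {L M : ℝ} (hL : 0 ≤ L)
    (hcut : ∀ A : Set V, A.Nonempty → Aᶜ.Nonempty →
      ∃ e, ¬ (G.src e ∈ A ↔ G.tgt e ∈ A) ∧ G.len e ≤ L) (hM0 : 0 ≤ M) (hM : ∀ e, G.len e ≤ M)
    (x y : G.Point) : G.dist x y ≤ M + ((Fintype.card V : ℝ) - 1) * L := by
  obtain ⟨v, a, ha, hxv, -⟩ := G.exists_vertex_near hM0 hM x
  obtain ⟨w, b, hb, -, hwy⟩ := G.exists_vertex_near hM0 hM y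
  obtain ⟨c, hc, hvw⟩ := G.exists_isPathLength_le_of_cut hL hcut v w
  have := dist_le_of_isPathLength (hxv.trans (hvw.trans hwy))
  linarith

/-- Distinct vertices have positive distance. -/
theorem Connected.dist_vertex_pos [Finite E] {G : MetricGraph V E} (hG : G.Connected) {v w : V}
    (hvw : v ≠ w) : 0 < G.dist (.vertex v) (.vertex w) := by
  classical
  have : Nonempty E := ⟨(hG.exists_edge_of_ne hvw).choose⟩
  obtain ⟨e₀, he₀⟩ := Finite.exists_min G.len
  set m := G.len e₀ with hm
  have hm0 : 0 < m := G.len_pos e₀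
  -- With `m` the shortest edge length, the linear extension of `φ` along edges is `1`-Lipschitz, so
  -- its increment `m` between `v` and `w` bounds path lengths from below.
  set φ : V → ℝ := fun u => if u = v then 0 else m with hφ
  set g : G.Point → ℝ := fun x => match x with
    | .vertex u => φ u
    | .inner e t _ => φ (G.src e) + (φ (G.tgt e) - φ (G.src e)) * (t / G.len e) with hg
  have hedge : ∀ x e s, G.OnEdge x e s →
      g x = φ (G.src e) + (φ (G.tgt e) - φ (G.src e)) * (s / G.len e) := by
    intro x e s h
    cases x with
    | vertex v =>
      rcases h with ⟨rfl, rfl⟩ | ⟨rfl, rfl⟩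
      · simp [hg]
      · simp [hg, (G.len_pos e).ne']
    | inner e' t ht =>
      obtain ⟨rfl, rfl⟩ := h
      rfl
  have hslope : ∀ e, |φ (G.tgt e) - φ (G.src e)| ≤ G.len e := by
    intro e
    have := he₀ e
    rw [abs_le]
    simp only [hφ]
    split_ifs <;> constructor <;> linarith
  have hlip : ∀ x y c, G.IsPathLength x y c → |g x - g y| ≤ c := by
    intro x y c h
    induction h with
    | nil => simp
    | @cons x y z e s t c hx hy _ ih =>
      have h1 : |g x - g y| ≤ |s - t| := by
        rw [hedge _ _ _ hx, hedge _ _ _ hy, show φ (G.src e) +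
          (φ (G.tgt e) - φ (G.src e)) * (s / G.len e) - (φ (G.src e) +
          (φ (G.tgt e) - φ (G.src e)) * (t / G.len e)) =
          (φ (G.tgt e) - φ (G.src e)) / G.len e * (s - t) by ring, abs_mul, abs_div,
          abs_of_pos (G.len_pos e)]
        exact mul_le_of_le_one_left (abs_nonneg _) ((div_le_one (G.len_pos e)).mpr (hslope e))
      exact (abs_sub_le _ _ _).trans (add_le_add h1 ih)
  refine hm0.trans_le (le_csInf (hG _ _) fun c hc => ?_)
  have := hlip _ _ _ hc
  simpa [hg, hφ, hvw.symm, abs_of_pos hm0] using this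

/-- The numbers below `L` in a finite family are bounded by some `L' < L`. -/
theorem exists_lt_forall_lt_le {ι : Type*} [Finite ι] (f : ι → ℝ) {L : ℝ} (hL : 0 < L) :
    ∃ L' < L, 0 ≤ L' ∧ ∀ i, f i < L → f i ≤ L' := by
  classical
  have := Fintype.ofFinite ι
  set s : Finset ℝ := insert 0 ((Finset.univ.image f).filter (· < L)) with hs
  have hne : s.Nonempty := Finset.insert_nonempty _ _
  refine ⟨s.max' hne, ?_, s.le_max' _ (Finset.mem_insert_self _ _), fun i hi => s.le_max' _ ?_⟩
  · rw [Finset.max'_lt_iff]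
    intro y hy
    rcases Finset.mem_insert.mp hy with rfl | hy
    · exact hL
    · exact (Finset.mem_filter.mp hy).2
  · exact Finset.mem_insert_of_mem (Finset.mem_filter.mpr ⟨by simp, hi⟩)

/-- Guarantees that the suprema defining the diameters are genuine, since `sSup` of an unbounded set
of reals is `0`. With the total length as both thresholds, connectedness supplies the crossing
edges. -/
theorem Connected.bddAbove_dist [Fintype V] [Fintype E] {G : MetricGraph V E}
    (hG : G.Connected) : ∃ B, ∀ x y, G.dist x y ≤ B := by
  classical
  have h0 : 0 ≤ ∑ e, G.len e := Finset.sum_nonneg fun e _ => (G.len_pos e).le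
  have hM : ∀ e, G.len e ≤ ∑ e, G.len e := fun e =>
    Finset.single_le_sum (fun e _ => (G.len_pos e).le) (Finset.mem_univ e)
  refine ⟨_, G.dist_le_of_cut h0 (fun A ⟨v, hv⟩ ⟨w, hw⟩ => ?_) h0 hM⟩
  by_contra h
  have := hG.eq_of_forall_edge (f := fun u => u ∈ A) (fun e => propext (by
    by_contra hne
    exact h ⟨e, hne, hM e⟩)) v w
  exact hw (this ▸ hv)

end MetricGraph
-- The two diameter bounds
theorem mainTheorem4 {V E : Type*} [Fintype V] [Fintype E] (G : MetricGraph V E)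
    (hG : G.Connected) (hV : 2 ≤ Fintype.card V) :
    IsLeast {μ : ℝ | 0 < μ ∧ G.IsEigenvalue μ} G.spectralGap ∧
    G.spectralGap ≤ Real.pi ^ 2 / G.diam ^ 2 * ((Fintype.card V : ℝ) + 1) ^ 2 ∧
    G.spectralGap ≤ Real.pi ^ 2 / G.vertexDiam ^ 2 * ((Fintype.card V : ℝ) - 1) ^ 2 := by
  have : Nontrivial V := Fintype.one_lt_card_iff_nontrivial.mp hV
  have hV' : (2 : ℝ) ≤ Fintype.card V := by exact_mod_cast hV
  obtain ⟨v₀, w₀, hvw⟩ := exists_pair_ne V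
  have hdist := hG.dist_vertex_pos hvw
  obtain ⟨b, hb⟩ := hG.bddAbove_dist
  have hD : 0 < G.diam := hdist.trans_le <| le_csSup ⟨b, by rintro _ ⟨x, y, rfl⟩; exact hb x y⟩
    ⟨.vertex v₀, .vertex w₀, rfl⟩
  have hDV : 0 < G.vertexDiam := hdist.trans_le <|
    le_csSup ⟨b, by rintro _ ⟨x, y, rfl⟩; exact hb _ _⟩ ⟨v₀, w₀, rfl⟩
  have hcut : ∀ L L' : ℝ, (∀ e, G.len e < L → G.len e ≤ L') →
      (¬ ∃ A : Set V, A.Nonempty ∧ Aᶜ.Nonempty ∧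
        ∀ e, ¬ (G.src e ∈ A ↔ G.tgt e ∈ A) → L ≤ G.len e) →
      ∀ A : Set V, A.Nonempty → Aᶜ.Nonempty →
        ∃ e, ¬ (G.src e ∈ A ↔ G.tgt e ∈ A) ∧ G.len e ≤ L' := by
    intro L L' hL' h A hA hA'
    push Not at h
    obtain ⟨e, he, hlt⟩ := h A hA hA'
    exact ⟨e, by tauto, hL' e hlt⟩
  have hvertex : IsLeast {μ : ℝ | 0 < μ ∧ G.IsEigenvalue μ} G.spectralGap ∧
      G.spectralGap ≤ (Real.pi / (G.vertexDiam / ((Fintype.card V : ℝ) - 1))) ^ 2 := by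
    have hc : 0 < (Fintype.card V : ℝ) - 1 := by linarith
    set L := G.vertexDiam / ((Fintype.card V : ℝ) - 1) with hLdef
    have hL : 0 < L := div_pos hDV hc
    by_cases h : ∃ A : Set V, A.Nonempty ∧ Aᶜ.Nonempty ∧
        ∀ e, ¬ (G.src e ∈ A ↔ G.tgt e ∈ A) → L ≤ G.len e
    · obtain ⟨A, hA, hA', hAcut⟩ := h
      exact MetricGraph.isLeast_spectralGap_of_cut hG hL hA hA' hAcut
    · exfalso
      -- A uniform bound `L' < L` is needed: the diameter is a supremum, so strict inequality for
      -- each pair would not give a contradiction.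
      obtain ⟨L', hlt, h0, hL'⟩ := MetricGraph.exists_lt_forall_lt_le G.len hL
      have hle : G.vertexDiam ≤ ((Fintype.card V : ℝ) - 1) * L' := by
        refine csSup_le ⟨_, v₀, w₀, rfl⟩ ?_
        rintro _ ⟨v, w, rfl⟩
        obtain ⟨c, hc, hp⟩ := G.exists_isPathLength_le_of_cut h0 (hcut L L' hL' h) v w
        exact (MetricGraph.dist_le_of_isPathLength hp).trans hc
      have h1 : ((Fintype.card V : ℝ) - 1) * L = G.vertexDiam := mul_div_cancel₀ _ hc.ne'
      have h2 := mul_lt_mul_of_pos_left hlt hc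
      linarith
  have hpoint : G.spectralGap ≤ (Real.pi / (G.diam / ((Fintype.card V : ℝ) + 1))) ^ 2 := by
    have hc : 0 < (Fintype.card V : ℝ) + 1 := by linarith
    set L := G.diam / ((Fintype.card V : ℝ) + 1) with hLdef
    have hL : 0 < L := div_pos hD hc
    by_cases h : ∃ A : Set V, A.Nonempty ∧ Aᶜ.Nonempty ∧
        ∀ e, ¬ (G.src e ∈ A ↔ G.tgt e ∈ A) → L ≤ G.len e
    · obtain ⟨A, hA, hA', hAcut⟩ := h
      exact (MetricGraph.isLeast_spectralGap_of_cut hG hL hA hA' hAcut).2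
    by_cases hlong : ∃ e, 2 * L ≤ G.len e
    · obtain ⟨e, he⟩ := hlong
      exact (MetricGraph.isLeast_spectralGap_of_edge hG hL he).2
    · exfalso
      push Not at hlong
      obtain ⟨L', hlt, h0, hL'⟩ := MetricGraph.exists_lt_forall_lt_le G.len hL
      -- With `M < 2 L` and `L' < L`, the diameter is at most `M + (V - 1) L' < (V + 1) L`, contrary
      -- to the choice of `L`.
      obtain ⟨M, hM, hM0, hM'⟩ :=
        MetricGraph.exists_lt_forall_lt_le G.len (show 0 < 2 * L by positivity)
      have hle : G.diam ≤ M + ((Fintype.card V : ℝ) - 1) * L' := by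
        refine csSup_le ⟨_, .vertex v₀, .vertex w₀, rfl⟩ ?_
        rintro _ ⟨x, y, rfl⟩
        exact G.dist_le_of_cut h0 (hcut L L' hL' h) hM0 (fun e => hM' e (hlong e)) x y
      have h1 : ((Fintype.card V : ℝ) + 1) * L = G.diam := mul_div_cancel₀ _ hc.ne'
      have h2 := mul_lt_mul_of_pos_left hlt (show 0 < (Fintype.card V : ℝ) - 1 by linarith)
      linarith
  refine ⟨hvertex.1, hpoint.trans_eq ?_, hvertex.2.trans_eq ?_⟩
  · rw [div_div_eq_mul_div, div_pow, mul_pow, div_mul_eq_mul_div]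
  · rw [div_div_eq_mul_div, div_pow, mul_pow, div_mul_eq_mul_div]
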